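/- Let $\lambda_1\ge\lambda_2\ge 2$ and $h_1\ge h_2\ge 2$ be integers and let $\lambda=(\lambda_1,\lambda_2,2^{h_2-2},1^{h_1-h_2})$ be the partition with parts $\lambda_1,\lambda_2$, followed by $h_2-2$ parts equal to $2$ and $h_1-h_2$ parts equal to $1$; let $n$ be its size. A semistandard Young tableau of shape $\lambda$ is a filling of the (left-justified) diagram of $\lambda$, whose $i$th row has $\lambda_i$ boxes, by positive integers such that entries weakly increase from left to right along each row and strictly increase along each column from the first row towards the last row. Such a tableau is called quasi-Yamanouchi if, for every $i\ge 2$ that appears in it, the leftmost instance of $i$ lies in a column weakly to the left of the column of some instance of $i-1$. Let $\mathrm{QYT}_{=m}(\lambda)$ be the number of quasi-Yamanouchi tableaux of shape $\lambda$ whose largest entry is exactly $m$. If $h_1\le m\le n-(\lambda_1-1)$, then $$\mathrm{QYT}_{=m}(\lambda)=\frac{\lambda_1-\lambda_2+1}{m-h_2+1}\binom{\lambda_1+h_1-2}{m-h_2}\binom{\lambda_2+h_1-3}{m-h_2}\binom{m-h_2}{m-h_1}\binom{\lambda_2+h_2-4}{h_2-2}\binom{\lambda_1+h_2-3}{h_2-2}\frac{1}{\binom{h_1-1}{h_2-2}}.$$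 -/

import Mathlib

namespace SemistandardYoungTableau

variable {μ : YoungDiagram}

/-- All entries in the cells of the diagram are positive integers. (Mathlib's semistandard tableaux
have natural-number entries, so that `0` has to be excluded separately.) -/
def IsPositive (T : SemistandardYoungTableau μ) : Prop :=
  ∀ r c : ℕ, (r, c) ∈ μ → 0 < T r c

/-- The cell in row `r` and column `c` is a leftmost instance of the entry `i`. -/
def IsLeftmostInstance (T : SemistandardYoungTableau μ) (i r c : ℕ) : Prop :=
  (r, c) ∈ μ ∧ T r c = i ∧ ∀ r' c' : ℕ, (r', c') ∈ μ → T r' c' = i → c ≤ c'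

/-- A tableau is quasi-Yamanouchi if, whenever `i > 1` appears, the leftmost instance of `i` is
weakly left of some instance of `i - 1`. -/
def IsQuasiYamanouchi (T : SemistandardYoungTableau μ) : Prop :=
  ∀ i r c : ℕ, 1 < i → T.IsLeftmostInstance i r c →
    ∃ r' c' : ℕ, (r', c') ∈ μ ∧ T r' c' = i - 1 ∧ c ≤ c'

/-- The set of entries in the cells of the diagram. -/
def entries (T : SemistandardYoungTableau μ) : Set ℕ :=
  {i | ∃ r c : ℕ, (r, c) ∈ μ ∧ T r c = i}

end SemistandardYoungTableau

/-- The quasi-Yamanouchi tableaux of shape `μ` (with positive entries) in which `m` is exactly the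
largest value that appears. -/
def quasiYamanouchiEq (μ : YoungDiagram) (m : ℕ) : Set (SemistandardYoungTableau μ) :=
  {T | T.IsPositive ∧ T.IsQuasiYamanouchi ∧ IsGreatest T.entries m}

/-! A quasi-Yamanouchi tableau can be dismantled cell by cell. Let `M` be its largest entry and `k`
the last column containing `M`; that column ends in a corner holding `M`. After deleting this
corner, either `M` survives, but only left of column `k`, or the new maximum is `M - 1` and occurs
in column `k` or beyond, as the quasi-Yamanouchi condition demands. Both cases are reversible, so
the counts refined by maximum and last column satisfy a recursion (`qyCount_erase`).

The shape is a double hook with at most four corners, and there the recursion closes on the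
unrefined counts. Its solution is the 2×2 determinant `hookDet` of products of binomials: the
products satisfy the recursion by Pascal's rule, and antisymmetry makes the determinant vanish where
a corner is missing because two arms or two legs end side by side
(`IsDoubleHook.qyCount_eq_hookDet`). The two terms of the determinant agree up to linear factors,
whence the product formula (`hookDet_eq_prod`). -/

namespace SemistandardYoungTableau

variable {μ ν : YoungDiagram}

/-! ### Deleting and adding a corner cell -/

/-- The largest entry of `T` is `M`, and `k` is the last column that contains it. -/
def HasLast (T : SemistandardYoungTableau μ) (M k : ℕ) : Prop :=
  (∃ r, (r, k) ∈ μ ∧ T r k = M) ∧ ∀ r c, (r, c) ∈ μ → T r c ≤ M ∧ (T r c = M → c ≤ k)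

/-- The restriction of a tableau to a smaller diagram. -/
def restrict (T : SemistandardYoungTableau μ) (h : ∀ i j, (i, j) ∈ ν → (i, j) ∈ μ) :
    SemistandardYoungTableau ν where
  entry i j := if (i, j) ∈ ν then T i j else 0
  row_weak' {i j1 j2} hj hc := by
    rw [if_pos hc, if_pos (ν.up_left_mem le_rfl hj.le hc)]
    exact T.row_weak hj (h _ _ hc)
  col_strict' {i1 i2 j} hi hc := by
    rw [if_pos hc, if_pos (ν.up_left_mem hi.le le_rfl hc)]
    exact T.col_strict hi (h _ _ hc)
  zeros' hc := if_neg hc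

theorem restrict_apply (T : SemistandardYoungTableau μ) (h : ∀ i j, (i, j) ∈ ν → (i, j) ∈ μ)
    {i j : ℕ} (hc : (i, j) ∈ ν) : T.restrict h i j = T i j :=
  if_pos hc

/-- The diagram `ν` is obtained from `μ` by deleting the cell `(r, k)`. -/
def IsErase (μ ν : YoungDiagram) (r k : ℕ) : Prop :=
  (r, k) ∈ μ ∧ ∀ i j, (i, j) ∈ ν ↔ (i, j) ∈ μ ∧ ¬(i = r ∧ j = k)

theorem exists_isErase {r k : ℕ} (hc : (r, k) ∈ μ) (hr : (r, k + 1) ∉ μ) (hk : (r + 1, k) ∉ μ) :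
    ∃ ν, IsErase μ ν r k := by
  have hlow : IsLowerSet (μ.cells.erase (r, k) : Set (ℕ × ℕ)) := by
    rintro ⟨i, j⟩ ⟨i', j'⟩ hle hm
    obtain ⟨h1, h2⟩ := Prod.mk_le_mk.1 hle
    simp only [Finset.coe_erase, Set.mem_sdiff, Finset.mem_coe, YoungDiagram.mem_cells,
      Set.mem_singleton_iff, Prod.mk.injEq] at hm ⊢
    refine ⟨μ.up_left_mem h1 h2 hm.1, ?_⟩
    rintro ⟨rfl, rfl⟩
    rcases Nat.lt_or_ge j' j with h | h
    · exact hr (μ.up_left_mem h1 h hm.1)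
    · rcases Nat.lt_or_ge i' i with h' | h'
      · exact hk (μ.up_left_mem h' h2 hm.1)
      · exact hm.2 ⟨le_antisymm h' h1, le_antisymm h h2⟩
  refine ⟨⟨μ.cells.erase (r, k), hlow⟩, hc, fun i j ↦ ?_⟩
  rw [YoungDiagram.mem_mk, Finset.mem_erase, YoungDiagram.mem_cells, and_comm, ne_eq,
    Prod.mk.injEq]

namespace IsErase

variable {r k : ℕ}

theorem mem_of_mem (h : IsErase μ ν r k) {i j : ℕ} (hc : (i, j) ∈ ν) : (i, j) ∈ μ :=
  ((h.2 i j).1 hc).1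

theorem notMem (h : IsErase μ ν r k) : (r, k) ∉ ν := fun hc ↦ ((h.2 r k).1 hc).2 ⟨rfl, rfl⟩

theorem row_le (h : IsErase μ ν r k) {i : ℕ} (hc : (i, k) ∈ μ) : i ≤ r := by
  by_contra! hlt
  exact h.notMem (ν.up_left_mem hlt.le le_rfl ((h.2 i k).2 ⟨hc, by omega⟩))

theorem col_le (h : IsErase μ ν r k) {j : ℕ} (hc : (r, j) ∈ μ) : j ≤ k := by
  by_contra! hlt
  exact h.notMem (ν.up_left_mem le_rfl hlt.le ((h.2 r j).2 ⟨hc, by omega⟩))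

/-- Extension of a tableau by one more cell with entry `M`. -/
def extend (h : IsErase μ ν r k) (T : SemistandardYoungTableau ν) (M : ℕ)
    (hrow : ∀ j, (r, j) ∈ ν → T r j ≤ M) (hcol : ∀ i, (i, k) ∈ ν → T i k < M) :
    SemistandardYoungTableau μ where
  entry i j := if i = r ∧ j = k then M else T i j
  row_weak' {i j1 j2} hj hc := by
    by_cases h2 : i = r ∧ j2 = k
    · obtain ⟨rfl, rfl⟩ := h2
      rw [if_neg (by omega), if_pos ⟨rfl, rfl⟩]
      exact hrow _ ((h.2 _ _).2 ⟨μ.up_left_mem le_rfl hj.le hc, by omega⟩)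
    · have h1 : ¬(i = r ∧ j1 = k) := by
        rintro ⟨rfl, rfl⟩
        have := h.col_le hc
        omega
      rw [if_neg h2, if_neg h1]
      exact T.row_weak hj ((h.2 _ _).2 ⟨hc, h2⟩)
  col_strict' {i1 i2 j} hi hc := by
    by_cases h2 : i2 = r ∧ j = k
    · obtain ⟨rfl, rfl⟩ := h2
      rw [if_neg (by omega), if_pos ⟨rfl, rfl⟩]
      exact hcol _ ((h.2 _ _).2 ⟨μ.up_left_mem hi.le le_rfl hc, by omega⟩)
    · have h1 : ¬(i1 = r ∧ j = k) := by
        rintro ⟨rfl, rfl⟩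
        have := h.row_le hc
        omega
      rw [if_neg h2, if_neg h1]
      exact T.col_strict hi ((h.2 _ _).2 ⟨hc, h2⟩)
  zeros' {i j} hc := by
    have h1 : ¬(i = r ∧ j = k) := by
      rintro ⟨rfl, rfl⟩
      exact hc h.1
    rw [if_neg h1]
    exact T.zeros fun h' ↦ hc (h.mem_of_mem h')

theorem extend_self (h : IsErase μ ν r k) (T : SemistandardYoungTableau ν) (M : ℕ)
    (hrow : ∀ j, (r, j) ∈ ν → T r j ≤ M) (hcol : ∀ i, (i, k) ∈ ν → T i k < M) :
    h.extend T M hrow hcol r k = M :=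
  if_pos ⟨rfl, rfl⟩

theorem extend_apply (h : IsErase μ ν r k) (T : SemistandardYoungTableau ν) (M : ℕ)
    (hrow : ∀ j, (r, j) ∈ ν → T r j ≤ M) (hcol : ∀ i, (i, k) ∈ ν → T i k < M) {i j : ℕ}
    (hc : (i, j) ∈ ν) : h.extend T M hrow hcol i j = T i j :=
  if_neg ((h.2 i j).1 hc).2

theorem mem_cases (h : IsErase μ ν r k) {i j : ℕ} (hc : (i, j) ∈ μ) :
    (i = r ∧ j = k) ∨ (i, j) ∈ ν := by
  by_cases h1 : i = r ∧ j = k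
  · exact Or.inl h1
  · exact Or.inr ((h.2 i j).2 ⟨hc, h1⟩)

end IsErase

/-! ### The last column of the largest entry -/

theorem HasLast.unique {T : SemistandardYoungTableau μ} {M k M' k' : ℕ} (h : T.HasLast M k)
    (h' : T.HasLast M' k') : M = M' ∧ k = k' := by
  obtain ⟨⟨r, hr, hT⟩, hall⟩ := h
  obtain ⟨⟨r', hr', hT'⟩, hall'⟩ := h'
  have h1 := hall _ _ hr'
  have h2 := hall' _ _ hr
  have h3 : M = M' := by omega
  subst h3
  exact ⟨rfl, le_antisymm (h2.2 hT) (h1.2 hT')⟩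

theorem exists_hasLast_of_isGreatest (T : SemistandardYoungTableau μ) {M : ℕ}
    (hM : IsGreatest T.entries M) : ∃ k, T.HasLast M k := by
  classical
  obtain ⟨⟨r, c, hc, hT⟩, hub⟩ := hM
  let s := μ.cells.filter fun x ↦ T x.1 x.2 = M
  have hs : s.Nonempty := ⟨(r, c), by simp [s, hc, hT]⟩
  obtain ⟨⟨r', k⟩, hx, hmax⟩ := s.exists_max_image Prod.snd hs
  simp only [s, Finset.mem_filter, YoungDiagram.mem_cells] at hx hmax
  exact ⟨k, ⟨r', hx⟩, fun i j hij ↦ ⟨hub ⟨i, j, hij, rfl⟩, fun h ↦ hmax (i, j) ⟨hij, h⟩⟩⟩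

theorem HasLast.isGreatest {T : SemistandardYoungTableau μ} {M k : ℕ} (h : T.HasLast M k) :
    IsGreatest T.entries M := by
  obtain ⟨⟨r, hr, hT⟩, hall⟩ := h
  refine ⟨⟨r, k, hr, hT⟩, ?_⟩
  rintro _ ⟨i, j, hij, rfl⟩
  exact (hall i j hij).1

theorem exists_hasLast (T : SemistandardYoungTableau μ) {i j : ℕ} (hij : (i, j) ∈ μ) :
    ∃ M k, T.HasLast M k := by
  obtain ⟨⟨r, c⟩, hc, hmax⟩ := μ.cells.exists_max_image (fun x ↦ T x.1 x.2) ⟨(i, j), by simpa⟩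
  rw [YoungDiagram.mem_cells] at hc
  refine ⟨T r c, T.exists_hasLast_of_isGreatest ⟨⟨r, c, hc, rfl⟩, ?_⟩⟩
  rintro _ ⟨i', j', h', rfl⟩
  exact hmax (i', j') (by simpa)

/-- The last column containing the largest entry ends in a corner of the diagram. -/
theorem HasLast.exists_corner {T : SemistandardYoungTableau μ} {M k : ℕ} (h : T.HasLast M k) :
    ∃ r, (r, k) ∈ μ ∧ (r, k + 1) ∉ μ ∧ (r + 1, k) ∉ μ := by
  obtain ⟨⟨r, hr, hT⟩, hall⟩ := h
  refine ⟨r, hr, fun hc ↦ ?_, fun hc ↦ ?_⟩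
  · have h1 := T.row_weak (Nat.lt_succ_self k) hc
    have h2 := hall _ _ hc
    have := h2.2 (by simp only [Nat.succ_eq_add_one] at h1; omega)
    omega
  · have h1 := T.col_strict (Nat.lt_succ_self r) hc
    have h2 := hall _ _ hc
    simp only [Nat.succ_eq_add_one] at h1
    omega

theorem HasLast.apply_corner {T : SemistandardYoungTableau μ} {M r k : ℕ} (h : T.HasLast M k)
    (he : IsErase μ ν r k) : T r k = M := by
  obtain ⟨⟨r', hr, hT⟩, hall⟩ := h
  have h1 := T.col_weak (he.row_le hr) he.1
  have h2 := (hall _ _ he.1).1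
  omega

/-- Finiteness is what makes `Set.ncard` additive on disjoint unions. -/
theorem finite_setOf_forall_le (μ : YoungDiagram) (M : ℕ) :
    {T : SemistandardYoungTableau μ | ∀ i j, (i, j) ∈ μ → T i j ≤ M}.Finite := by
  have hinj : Set.InjOn
      (fun (T : SemistandardYoungTableau μ) (c : μ.cells) ↦ T c.1.1 c.1.2) Set.univ := by
    intro T _ T' _ h
    ext i j
    by_cases hc : (i, j) ∈ μ
    · exact congrFun h ⟨(i, j), by simpa⟩
    · rw [T.zeros hc, T'.zeros hc]
  refine Set.Finite.of_finite_image ((Set.finite_Iic (fun _ : μ.cells ↦ M)).subset ?_)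
    (hinj.mono (Set.subset_univ _))
  rintro _ ⟨T, hT, rfl⟩ ⟨⟨i, j⟩, hc⟩
  exact hT i j (by simpa using hc)

/-! ### Counts refined by the last column -/

/-- Quasi-Yamanouchi tableaux whose largest entry is `m` and in which the last column containing
`m` satisfies `P`. -/
def qySet (μ : YoungDiagram) (m : ℤ) (P : ℕ → Prop) : Set (SemistandardYoungTableau μ) :=
  {T | T.IsPositive ∧ T.IsQuasiYamanouchi ∧ ∃ M k : ℕ, (M : ℤ) = m ∧ P k ∧ T.HasLast M k}

/-- The number of quasi-Yamanouchi tableaux whose largest entry is `m` and in which the last column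
containing `m` satisfies `P`. -/
noncomputable def qyCount (μ : YoungDiagram) (m : ℤ) (P : ℕ → Prop) : ℤ :=
  (qySet μ m P).ncard

theorem finite_qySet (μ : YoungDiagram) (m : ℤ) (P : ℕ → Prop) : (qySet μ m P).Finite := by
  refine (finite_setOf_forall_le μ m.toNat).subset ?_
  rintro T ⟨-, -, M, k, rfl, -, -, h⟩ i j hij
  simpa using (h i j hij).1

theorem qySet_true (μ : YoungDiagram) (m : ℕ) :
    qySet μ m (fun _ ↦ True) = quasiYamanouchiEq μ m := by
  ext T
  constructor
  · rintro ⟨h1, h2, M, k, hM, -, h⟩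
    obtain rfl : M = m := by exact_mod_cast hM
    exact ⟨h1, h2, h.isGreatest⟩
  · rintro ⟨h1, h2, h⟩
    obtain ⟨k, hk⟩ := T.exists_hasLast_of_isGreatest h
    exact ⟨h1, h2, m, k, rfl, trivial, hk⟩

/-- Additivity of `qyCount` in the condition on the column, where only corner columns matter. -/
theorem qyCount_add (m : ℤ) {P Q R : ℕ → Prop}
    (hdisj : ∀ k, P k → Q k → False)
    (hR : ∀ r k, (r, k) ∈ μ → (r, k + 1) ∉ μ → (r + 1, k) ∉ μ → (R k ↔ P k ∨ Q k)) :
    qyCount μ m R = qyCount μ m P + qyCount μ m Q := by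
  have hU : qySet μ m R = qySet μ m P ∪ qySet μ m Q := by
    ext T
    constructor
    · rintro ⟨h1, h2, M, k, hM, hk, h⟩
      obtain ⟨r, hr, hr1, hr2⟩ := h.exists_corner
      rcases (hR r k hr hr1 hr2).1 hk with hk | hk
      · exact Or.inl ⟨h1, h2, M, k, hM, hk, h⟩
      · exact Or.inr ⟨h1, h2, M, k, hM, hk, h⟩
    · rintro (⟨h1, h2, M, k, hM, hk, h⟩ | ⟨h1, h2, M, k, hM, hk, h⟩)
      all_goals
        obtain ⟨r, hr, hr1, hr2⟩ := h.exists_corner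
        refine ⟨h1, h2, M, k, hM, (hR r k hr hr1 hr2).2 (by tauto), h⟩
  have hD : Disjoint (qySet μ m P) (qySet μ m Q) := by
    rw [Set.disjoint_left]
    rintro T ⟨-, -, M, k, -, hk, h⟩ ⟨-, -, M', k', -, hk', h'⟩
    obtain ⟨-, rfl⟩ := h.unique h'
    exact hdisj k hk hk'
  rw [qyCount, hU, Set.ncard_union_eq hD (finite_qySet _ _ _) (finite_qySet _ _ _)]
  simp [qyCount]

theorem qyCount_eq_zero (m : ℤ) {P : ℕ → Prop}
    (hP : ∀ r k, (r, k) ∈ μ → (r, k + 1) ∉ μ → (r + 1, k) ∉ μ → ¬P k) :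
    qyCount μ m P = 0 := by
  have : qySet μ m P = ∅ := by
    rw [Set.eq_empty_iff_forall_notMem]
    rintro T ⟨-, -, M, k, -, hk, h⟩
    obtain ⟨r, hr, hr1, hr2⟩ := h.exists_corner
    exact hP r k hr hr1 hr2 hk
  simp [qyCount, this]

theorem qyCount_congr (m : ℤ) {P Q : ℕ → Prop}
    (h : ∀ r k, (r, k) ∈ μ → (r, k + 1) ∉ μ → (r + 1, k) ∉ μ → (P k ↔ Q k)) :
    qyCount μ m P = qyCount μ m Q := by
  rw [qyCount_add m (P := Q) (Q := fun _ ↦ False) (by simp) (by simpa using h),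
    qyCount_eq_zero m (P := fun _ ↦ False) (by simp), add_zero]

/-! ### The deletion recursion -/

section Erase

variable {r k : ℕ} {m : ℤ}

theorem restrict_mem_qySet (he : IsErase μ ν r k) (hne : ∃ i j, (i, j) ∈ ν)
    {T : SemistandardYoungTableau μ} (hT : T ∈ qySet μ m (· = k)) :
    T.restrict (fun _ _ ↦ he.mem_of_mem) ∈ qySet ν m (· < k) ∪ qySet ν (m - 1) (k ≤ ·) := by
  obtain ⟨hpos, hqy, M, k, rfl, rfl, hlast⟩ := hT
  have hc := hlast.apply_corner he
  set T' := T.restrict (fun _ _ ↦ he.mem_of_mem) with hT'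
  have happ : ∀ {i j}, (i, j) ∈ ν → T' i j = T i j := T.restrict_apply _
  obtain ⟨i₀, j₀, h₀⟩ := hne
  obtain ⟨M', k', h'⟩ := T'.exists_hasLast h₀
  have hpos' : T'.IsPositive := fun i j hij ↦ by
    rw [happ hij]
    exact hpos i j (he.mem_of_mem hij)
  obtain ⟨r', hr', hM'⟩ := h'.1
  have hM'pos : 0 < M' := hM' ▸ hpos' _ _ hr'
  have hle : M' ≤ M := by
    rw [← hM', happ hr']
    exact (hlast.2 _ _ (he.mem_of_mem hr')).1
  have hlt : M' = M → k' < k := by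
    intro hMM
    rw [happ hr', hMM] at hM'
    have h1 := (hlast.2 _ _ (he.mem_of_mem hr')).2 hM'
    -- Equality would put `M` twice in column `k`, against strictness.
    refine lt_of_le_of_ne h1 ?_
    rintro rfl
    have h2 : r' < r := lt_of_le_of_ne (he.row_le (he.mem_of_mem hr'))
      (by rintro rfl; exact he.notMem hr')
    have := T.col_strict h2 he.1
    omega
  have hqy' : T'.IsQuasiYamanouchi := by
    rintro i r₁ c₁ hi ⟨h1, h2, h3⟩
    rw [happ h1] at h2
    have hiM : i ≤ M' := by
      have := (h'.2 _ _ h1).1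
      rw [happ h1] at this
      omega
    -- A leftmost instance in `T'` stays leftmost in `T`: the restored cell matters only for `i =
    -- M`, and then `M` already occurs in `T'`, left of column `k`.
    obtain ⟨r₂, c₂, h4, h5, h6⟩ := hqy i r₁ c₁ hi ⟨he.mem_of_mem h1, h2, fun r₂ c₂ h4 h5 ↦ by
      rcases he.mem_cases h4 with ⟨rfl, rfl⟩ | h4
      · have hMM : M' = M := by omega
        have := (h'.2 _ _ h1).2 (by rw [happ h1]; omega)
        have := hlt hMM
        omega
      · exact h3 r₂ c₂ h4 (by rw [happ h4]; exact h5)⟩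
    rcases he.mem_cases h4 with ⟨rfl, rfl⟩ | h4
    · omega
    · exact ⟨r₂, c₂, h4, by rw [happ h4]; exact h5, h6⟩
  rcases hle.eq_or_lt with hMM | hMM
  · exact Or.inl ⟨hpos', hqy', M', k', by rw [hMM], hlt hMM, h'⟩
  · right
    -- Here `(r, k)` is the only cell with entry `M`, hence its leftmost instance; the condition
    -- supplies an `M - 1` in column `k` or later, so `M' = M - 1`.
    obtain ⟨r₂, c₂, h4, h5, h6⟩ := hqy M r k (by omega) ⟨he.1, hc, fun r₂ c₂ h4 h5 ↦ by
      rcases he.mem_cases h4 with ⟨rfl, rfl⟩ | h4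
      · exact le_rfl
      · have := (h'.2 _ _ h4).1
        rw [happ h4] at this
        omega⟩
    rcases he.mem_cases h4 with ⟨rfl, rfl⟩ | h4
    · omega
    · have h7 := h'.2 _ _ h4
      rw [happ h4] at h7
      have := h7.2 (by omega)
      refine ⟨hpos', hqy', M', k', by omega, ?_, h'⟩
      omega

theorem exists_restrict_eq (he : IsErase μ ν r k) {T' : SemistandardYoungTableau ν} {M M' k' : ℕ}
    (hpos' : T'.IsPositive) (hqy' : T'.IsQuasiYamanouchi) (h' : T'.HasLast M' k')
    (hM : (k' < k ∧ M = M') ∨ (k ≤ k' ∧ M = M' + 1)) :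
    ∃ T ∈ qySet μ M (· = k), T.restrict (fun _ _ ↦ he.mem_of_mem) = T' := by
  have hrow : ∀ j, (r, j) ∈ ν → T' r j ≤ M := fun j hj ↦ by
    have := (h'.2 _ _ hj).1
    omega
  have hcol : ∀ i, (i, k) ∈ ν → T' i k < M := fun i hi ↦ by
    have h1 := h'.2 _ _ hi
    rcases hM with ⟨h2, rfl⟩ | ⟨h2, rfl⟩
    · refine lt_of_le_of_ne h1.1 fun h3 ↦ ?_
      have := h1.2 h3
      omega
    · omega
  set T := he.extend T' M hrow hcol with hT
  have hself : T r k = M := he.extend_self T' M hrow hcol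
  have happ : ∀ {i j}, (i, j) ∈ ν → T i j = T' i j := he.extend_apply T' M hrow hcol
  obtain ⟨r', hr', hTM'⟩ := h'.1
  have hM'pos : 0 < M' := hTM' ▸ hpos' _ _ hr'
  refine ⟨T, ⟨fun i j hij ↦ ?_, ?_, M, k, rfl, rfl, ⟨r, he.1, hself⟩, fun i j hij ↦ ?_⟩, ?_⟩
  · rcases he.mem_cases hij with ⟨rfl, rfl⟩ | hij
    · omega
    · rw [happ hij]
      exact hpos' i j hij
  · rintro i r₁ c₁ hi ⟨h1, h2, h3⟩
    rcases he.mem_cases h1 with ⟨rfl, rfl⟩ | h1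
    -- The new cell is not leftmost if `M` already sits in column `k' < k`; otherwise the old
    -- maximum in column `k'` is the required witness.
    · rcases hM with ⟨h4, rfl⟩ | ⟨h4, rfl⟩
      · have := h3 r' k' (he.mem_of_mem hr') (by rw [happ hr']; omega)
        omega
      · exact ⟨r', k', he.mem_of_mem hr', by rw [happ hr']; omega, h4⟩
    · obtain ⟨r₂, c₂, h4, h5, h6⟩ := hqy' i r₁ c₁ hi ⟨h1, by rw [← happ h1]; exact h2,
        fun r₂ c₂ h4 h5 ↦ h3 r₂ c₂ (he.mem_of_mem h4) (by rw [happ h4]; exact h5)⟩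
      exact ⟨r₂, c₂, he.mem_of_mem h4, by rw [happ h4]; exact h5, h6⟩
  · rcases he.mem_cases hij with ⟨rfl, rfl⟩ | hij
    · exact ⟨hself.le, fun _ ↦ le_rfl⟩
    · rw [happ hij]
      have := h'.2 _ _ hij
      refine ⟨by omega, fun h ↦ ?_⟩
      have := this.2 (by omega)
      omega
  · ext i j
    by_cases hc : (i, j) ∈ ν
    · rw [restrict_apply _ _ hc, happ hc]
    · rw [T'.zeros hc, zeros _ hc]

/-- Deleting the rightmost cell that contains the largest entry. -/
theorem qyCount_erase (he : IsErase μ ν r k) (hne : ∃ i j, (i, j) ∈ ν) (m : ℤ) :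
    qyCount μ m (· = k) = qyCount ν m (· < k) + qyCount ν (m - 1) (k ≤ ·) := by
  have hD : Disjoint (qySet ν m (· < k)) (qySet ν (m - 1) (k ≤ ·)) := by
    rw [Set.disjoint_left]
    rintro T ⟨-, -, M, k, h1, -, h⟩ ⟨-, -, M', k', h2, -, h'⟩
    have := (h.unique h').1
    omega
  have hB : Set.BijOn (fun T : SemistandardYoungTableau μ ↦
      T.restrict (ν := ν) (fun _ _ ↦ he.mem_of_mem)) (qySet μ m (· = k))
      (qySet ν m (· < k) ∪ qySet ν (m - 1) (k ≤ ·)) := by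
    refine ⟨fun T hT ↦ restrict_mem_qySet he hne hT, ?_, ?_⟩
    · rintro T ⟨-, -, M, _, hM, rfl, h⟩ T' ⟨-, -, M', _, hM', rfl, h'⟩ heq
      have h1 := h.apply_corner he
      have h2 := h'.apply_corner he
      ext i j
      by_cases hc : (i, j) ∈ μ
      · rcases he.mem_cases hc with ⟨rfl, rfl⟩ | hc
        · omega
        · have := DFunLike.congr_fun heq i
          have := congrFun this j
          simpa only [restrict_apply _ _ hc] using this
      · rw [T.zeros hc, T'.zeros hc]
    · rintro T' (⟨hp, hq, M', k', hM', hk', h'⟩ | ⟨hp, hq, M', k', hM', hk', h'⟩)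
      · obtain ⟨T, hT, h⟩ := exists_restrict_eq he (M := M') hp hq h' (Or.inl ⟨hk', rfl⟩)
        exact ⟨T, by rwa [← hM'], h⟩
      · obtain ⟨T, hT, h⟩ := exists_restrict_eq he (M := M' + 1) hp hq h' (Or.inr ⟨hk', rfl⟩)
        refine ⟨T, ?_, h⟩
        obtain rfl : m = ((M' + 1 : ℕ) : ℤ) := by push_cast; omega
        exact hT
  rw [qyCount, ← hB.injOn.ncard_image, hB.image_eq,
    Set.ncard_union_eq hD (finite_qySet _ _ _) (finite_qySet _ _ _)]
  simp [qyCount]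

end Erase

end SemistandardYoungTableau

/-! ### The determinant and its recursion -/

/-- The binomial coefficient with an integer lower index. -/
def chooseInt (n : ℕ) (k : ℤ) : ℤ := if 0 ≤ k then n.choose k.toNat else 0

theorem chooseInt_natCast (n k : ℕ) : chooseInt n k = n.choose k := by
  simp [chooseInt]

theorem chooseInt_of_neg (n : ℕ) {k : ℤ} (hk : k < 0) : chooseInt n k = 0 :=
  if_neg (by omega)

theorem chooseInt_of_lt {n : ℕ} {k : ℤ} (hk : n < k) : chooseInt n k = 0 := by
  lift k to ℕ using by omega
  rw [chooseInt_natCast, Nat.choose_eq_zero_of_lt (by omega), Nat.cast_zero]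

/-- The zero convention for negative `k` makes Pascal's rule unconditional, so the recursions below
hold for every integer `m`. -/
theorem chooseInt_succ (n : ℕ) (k : ℤ) :
    chooseInt (n + 1) k = chooseInt n k + chooseInt n (k - 1) := by
  rcases lt_trichotomy k 0 with hk | rfl | hk
  · rw [chooseInt_of_neg _ hk, chooseInt_of_neg _ hk, chooseInt_of_neg _ (by omega), add_zero]
  · simp [chooseInt]
  · obtain ⟨j, rfl⟩ : ∃ j : ℕ, k = (j + 1 : ℕ) := ⟨(k - 1).toNat, by omega⟩
    rw [show ((j + 1 : ℕ) : ℤ) - 1 = j by push_cast; ring]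
    simp only [chooseInt_natCast, Nat.choose_succ_succ]
    push_cast
    ring

/-- The contribution of a pair of hooks `(x - 1 | b)`, `(e - 1 | d)` to the number of
quasi-Yamanouchi tableaux with largest entry `m`. -/
def hookPair (x b e d : ℕ) (m : ℤ) : ℤ :=
  x.multichoose b * e.multichoose d * chooseInt (b + e) (m - d - 1) * chooseInt (x + d) (m - b - 1)

/-- The determinantal expression for the number of quasi-Yamanouchi tableaux of a double hook. -/
def hookDet (x b e d : ℕ) (m : ℤ) : ℤ := hookPair x b e d m - hookPair x d e b m

theorem hookPair_swap (x b e d : ℕ) (m : ℤ) : hookPair x b e d m = hookPair e d x b m := by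
  simp only [hookPair, add_comm]
  ring

/-- Pascal's rule splits each of the four factors in two; every term on the right is then a product
of these halves, and the identity is polynomial. The terms mirror the deletions at the four corners
of a double hook. -/
theorem hookPair_succ (x b e d : ℕ) (m : ℤ) :
    hookPair (x + 1) (b + 1) (e + 1) (d + 1) m =
      hookPair x (b + 1) (e + 1) (d + 1) m + hookPair (x + 1) (b + 1) e (d + 1) m
      - hookPair x (b + 1) e (d + 1) m + hookPair x (b + 1) e (d + 1) (m - 1)
      + hookPair (x + 1) b (e + 1) (d + 1) (m - 1) + hookPair (x + 1) (b + 1) (e + 1) d (m - 1)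
      + hookPair (x + 1) b (e + 1) d (m - 1) - hookPair (x + 1) b (e + 1) d (m - 2) := by
  have hp := chooseInt_succ (b + 1 + e) (m - d - 2)
  have hq := chooseInt_succ (x + (d + 1)) (m - b - 2)
  simp only [hookPair, Nat.multichoose_succ_succ]
  push_cast
  rw [show b + 1 + (e + 1) = b + 1 + e + 1 by ring, show x + 1 + (d + 1) = x + (d + 1) + 1 by ring,
    show b + (e + 1) = b + 1 + e by ring, show x + 1 + d = x + (d + 1) by ring,
    show m - (d + 1 : ℤ) - 1 = m - d - 2 by ring, show m - (b + 1 : ℤ) - 1 = m - b - 2 by ring,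
    show m - 1 - (d + 1 : ℤ) - 1 = m - d - 2 - 1 by ring,
    show m - 1 - (b + 1 : ℤ) - 1 = m - b - 2 - 1 by ring,
    show m - 1 - (d : ℤ) - 1 = m - d - 2 by ring, show m - 1 - (b : ℤ) - 1 = m - b - 2 by ring,
    show m - 2 - (d : ℤ) - 1 = m - d - 2 - 1 by ring,
    show m - 2 - (b : ℤ) - 1 = m - b - 2 - 1 by ring, hp, hq]
  ring

/-- With no inner leg, `multichoose (e + 1) 0 = 1` does not split and the terms for an inner leg
deletion disappear. -/
theorem hookPair_succ_zero (x b e : ℕ) (m : ℤ) :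
    hookPair (x + 1) (b + 1) (e + 1) 0 m =
      hookPair x (b + 1) (e + 1) 0 m + hookPair (x + 1) (b + 1) e 0 m
      - hookPair x (b + 1) e 0 m + hookPair x (b + 1) e 0 (m - 1)
      + hookPair (x + 1) b (e + 1) 0 (m - 1) := by
  have hp := chooseInt_succ (b + 1 + e) (m - 1)
  have hq := chooseInt_succ x (m - b - 2)
  simp only [hookPair, Nat.multichoose_succ_succ, Nat.multichoose_zero_right]
  push_cast
  rw [show b + 1 + (e + 1) = b + 1 + e + 1 by ring, show x + 1 + 0 = x + 1 by ring,
    show x + 0 = x by ring,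
    show b + (e + 1) = b + 1 + e by ring,
    show m - (0 : ℤ) - 1 = m - 1 by ring, show m - (b + 1 : ℤ) - 1 = m - b - 2 by ring,
    show m - 1 - (0 : ℤ) - 1 = m - 1 - 1 by ring,
    show m - 1 - (b + 1 : ℤ) - 1 = m - b - 2 - 1 by ring,
    show m - 1 - (b : ℤ) - 1 = m - b - 2 by ring, hp, hq]
  ring

theorem hookDet_succ (x b e d : ℕ) (m : ℤ) :
    hookDet (x + 1) (b + 1) (e + 1) (d + 1) m =
      hookDet x (b + 1) (e + 1) (d + 1) m + hookDet (x + 1) (b + 1) e (d + 1) m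
      - hookDet x (b + 1) e (d + 1) m + hookDet x (b + 1) e (d + 1) (m - 1)
      + hookDet (x + 1) b (e + 1) (d + 1) (m - 1) + hookDet (x + 1) (b + 1) (e + 1) d (m - 1)
      + hookDet (x + 1) b (e + 1) d (m - 1) - hookDet (x + 1) b (e + 1) d (m - 2) := by
  simp only [hookDet]
  rw [hookPair_succ x b e d m, hookPair_succ x d e b m]
  ring

theorem hookDet_succ_zero (x b e : ℕ) (m : ℤ) :
    hookDet (x + 1) (b + 1) (e + 1) 0 m =
      hookDet x (b + 1) (e + 1) 0 m + hookDet (x + 1) (b + 1) e 0 m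
      - hookDet x (b + 1) e 0 m + hookDet x (b + 1) e 0 (m - 1)
      + hookDet (x + 1) b (e + 1) 0 (m - 1) := by
  simp only [hookDet]
  -- In the second product the zero leg belongs to the first hook, so the hooks are exchanged before
  -- the recursion applies.
  rw [hookPair_succ_zero x b e m, hookPair_swap (x + 1) 0 (e + 1) (b + 1) m,
    hookPair_succ_zero e b x m, hookPair_swap x 0 (e + 1) (b + 1) m,
    hookPair_swap (x + 1) 0 e (b + 1) m, hookPair_swap x 0 e (b + 1) m,
    hookPair_swap x 0 e (b + 1) (m - 1), hookPair_swap (x + 1) 0 (e + 1) b (m - 1)]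
  ring

/-- This and the next two vanishing statements cover the deletions that are impossible because the
cell in question is not a corner. -/
theorem hookDet_self_leg (x b e : ℕ) (m : ℤ) : hookDet x b e b m = 0 := sub_self _

theorem hookDet_self_arm (x b d : ℕ) (m : ℤ) : hookDet x b x d m = 0 := by
  rw [hookDet, hookPair_swap x d x b m, sub_self]

theorem hookDet_zero_succ (x b d : ℕ) (m : ℤ) : hookDet x (b + 1) 0 (d + 1) m = 0 := by
  simp [hookDet, hookPair]

theorem hookDet_zero_zero (x b : ℕ) (m : ℤ) :
    hookDet x (b + 1) 0 0 m = if m = b + 2 then (x.multichoose (b + 1) : ℤ) else 0 := by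
  simp only [hookDet, hookPair, Nat.multichoose_zero_succ, Nat.multichoose_zero_right, add_zero]
  push_cast
  split_ifs with h
  · subst h
    have h1 : chooseInt (b + 1) ((b : ℤ) + 2 - 0 - 1) = 1 := by
      rw [show (b : ℤ) + 2 - 0 - 1 = ((b + 1 : ℕ) : ℤ) by push_cast; ring, chooseInt_natCast]
      simp
    have h2 : chooseInt x ((b : ℤ) + 2 - (b + 1) - 1) = 1 := by
      rw [show (b : ℤ) + 2 - (b + 1) - 1 = ((0 : ℕ) : ℤ) by push_cast; ring, chooseInt_natCast]
      simp
    rw [h1, h2]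
    ring
  · rcases lt_or_gt_of_ne h with h | h
    · rw [chooseInt_of_neg x (k := m - (b + 1) - 1) (by omega)]
      ring
    · rw [chooseInt_of_lt (n := b + 1) (k := m - 0 - 1) (by push_cast; omega)]
      ring

/-! ### Deletion at the four corners of a double hook -/

namespace SemistandardYoungTableau

variable {μ : YoungDiagram} {a b e d : ℕ}

/-- The diagram `μ` consists of the hook with arm `a` and leg `b` at `(0, 0)`, and, if `0 < e`, of
the hook with arm `e - 1` and leg `d` at `(1, 1)`. -/
def IsDoubleHook (μ : YoungDiagram) (a b e d : ℕ) : Prop :=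
  ∀ i j, (i, j) ∈ μ ↔ (i = 0 ∧ j ≤ a) ∨ (j = 0 ∧ i ≤ b) ∨ (i = 1 ∧ 1 ≤ j ∧ j ≤ e) ∨
    (j = 1 ∧ 1 ≤ i ∧ i ≤ d + 1 ∧ 1 ≤ e)

theorem IsDoubleHook.nonempty (h : IsDoubleHook μ a b e d) : ∃ i j, (i, j) ∈ μ :=
  ⟨0, 0, by rw [h]; omega⟩

/-- Every column of the smaller diagram lies left of `a + 1`, so the maximum always survives. -/
theorem IsDoubleHook.qyCount_arm (h : IsDoubleHook μ (a + 1) b e d) (he : e ≤ a) :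
    ∃ ν, IsDoubleHook ν a b e d ∧
      ∀ m, qyCount μ m (· = a + 1) = qyCount ν m (fun _ ↦ True) := by
  obtain ⟨ν, hν⟩ := exists_isErase (μ := μ) (r := 0) (k := a + 1)
    (by rw [h]; omega) (by rw [h]; omega) (by rw [h]; omega)
  have h' : IsDoubleHook ν a b e d := fun i j ↦ by
    rw [hν.2, h]
    omega
  refine ⟨ν, h', fun m ↦ ?_⟩
  rw [qyCount_erase hν h'.nonempty, qyCount_congr m (Q := fun _ ↦ True),
    qyCount_eq_zero (m - 1), add_zero]
  all_goals
    intro r k h1 h2 h3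
    rw [h'] at h1
    try simp only [iff_true]
    omega

/-- No column lies left of column 0, so the maximum always drops by one. -/
theorem IsDoubleHook.qyCount_leg (h : IsDoubleHook μ a (b + 1) e d) (hd : 1 ≤ e → d + 1 ≤ b) :
    ∃ ν, IsDoubleHook ν a b e d ∧
      ∀ m, qyCount μ m (· = 0) = qyCount ν (m - 1) (fun _ ↦ True) := by
  obtain ⟨ν, hν⟩ := exists_isErase (μ := μ) (r := b + 1) (k := 0)
    (by rw [h]; omega) (by rw [h]; omega) (by rw [h]; omega)
  have h' : IsDoubleHook ν a b e d := fun i j ↦ by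
    rw [hν.2, h]
    omega
  refine ⟨ν, h', fun m ↦ ?_⟩
  rw [qyCount_erase hν h'.nonempty, qyCount_congr (m - 1) (Q := fun _ ↦ True),
    qyCount_eq_zero m, zero_add]
  all_goals simp

/-- Only column 0 lies left of the deleted cell; its contribution is separated from the total. -/
theorem IsDoubleHook.qyCount_inner_leg (h : IsDoubleHook μ a b e (d + 1)) (he : 1 ≤ e)
    (hea : e ≤ a) (hd : d + 2 ≤ b) :
    ∃ ν, IsDoubleHook ν a b e d ∧
      ∀ m, qyCount μ m (· = 1) = qyCount ν m (· = 0) + qyCount ν (m - 1) (fun _ ↦ True)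
        - qyCount ν (m - 1) (· = 0) := by
  obtain ⟨ν, hν⟩ := exists_isErase (μ := μ) (r := d + 2) (k := 1)
    (by rw [h]; omega) (by rw [h]; omega) (by rw [h]; omega)
  have h' : IsDoubleHook ν a b e d := fun i j ↦ by
    rw [hν.2, h]
    omega
  refine ⟨ν, h', fun m ↦ ?_⟩
  rw [qyCount_erase hν h'.nonempty, qyCount_congr m (P := (· < 1)) (Q := (· = 0)) (by simp),
    qyCount_add (m - 1) (P := (· = 0)) (Q := (1 ≤ ·)) (R := fun _ ↦ True)]
  · ring
  · omega
  · intros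
    simp only [true_iff]
    omega

/-- After the deletion, the only corner column not left of `e + 1` is the end `a` of the outer arm.
The condition `hed` says that `(1, e + 1)` has no cell below it. -/
theorem IsDoubleHook.qyCount_inner_arm (h : IsDoubleHook μ a b (e + 1) d) (hea : e + 1 ≤ a)
    (hd : d + 1 ≤ b) (hed : 1 ≤ e ∨ d = 0) :
    ∃ ν, IsDoubleHook ν a b e d ∧
      ∀ m, qyCount μ m (· = e + 1) = qyCount ν m (fun _ ↦ True) - qyCount ν m (· = a)
        + qyCount ν (m - 1) (· = a) := by
  obtain ⟨ν, hν⟩ := exists_isErase (μ := μ) (r := 1) (k := e + 1)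
    (by rw [h]; omega) (by rw [h]; omega) (by rw [h]; omega)
  have h' : IsDoubleHook ν a b e d := fun i j ↦ by
    rw [hν.2, h]
    omega
  have hcor : ∀ r k, (r, k) ∈ ν → (r, k + 1) ∉ ν → (r + 1, k) ∉ ν → k ≤ e ∨ k = a := by
    intro r k h1 h2 h3
    rw [h'] at h1 h2 h3
    omega
  refine ⟨ν, h', fun m ↦ ?_⟩
  rw [qyCount_erase hν h'.nonempty, qyCount_congr (m - 1) (P := (e + 1 ≤ ·)) (Q := (· = a)),
    qyCount_add m (P := (· < e + 1)) (Q := (· = a)) (R := fun _ ↦ True)]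
  · ring
  · omega
  all_goals
    intro r k h1 h2 h3
    have := hcor r k h1 h2 h3
    try simp only [true_iff]
    omega

end SemistandardYoungTableau

/-! ### Counting tableaux of hooks and double hooks -/

namespace SemistandardYoungTableau

variable {μ : YoungDiagram} {a b e d : ℕ}

/-- Base case: deleting the only cell leaves the empty diagram, which has no largest entry, so
`qyCount_erase` does not apply. -/
theorem qyCount_singleton (h : IsDoubleHook μ 0 0 0 0) (m : ℤ) :
    qyCount μ m (fun _ ↦ True) = if m = 1 then 1 else 0 := by
  have hmem : ∀ i j, (i, j) ∈ μ ↔ i = 0 ∧ j = 0 := fun i j ↦ by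
    rw [h]
    omega
  have hval : ∀ T ∈ qySet μ m (fun _ ↦ True), m = 1 ∧ T 0 0 = 1 := by
    rintro T ⟨hpos, hqy, M, k, rfl, -, ⟨r, hr, hM⟩, -⟩
    obtain ⟨rfl, rfl⟩ := (hmem _ _).1 hr
    have h0 := hpos _ _ hr
    by_cases h1 : M = 1
    · subst h1
      exact ⟨rfl, hM⟩
    · obtain ⟨r', c', h2, h3, -⟩ := hqy M 0 0 (by omega) ⟨hr, hM, fun _ _ _ _ ↦ Nat.zero_le _⟩
      obtain ⟨rfl, rfl⟩ := (hmem _ _).1 h2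
      omega
  split_ifs with hm
  · subst hm
    let T : SemistandardYoungTableau μ :=
      { entry := fun i j ↦ if i = 0 ∧ j = 0 then 1 else 0
        row_weak' := fun {i j1 j2} hj hc ↦ by
          have := (hmem _ _).1 hc
          omega
        col_strict' := fun {i1 i2 j} hi hc ↦ by
          have := (hmem _ _).1 hc
          omega
        zeros' := fun {i j} hc ↦ if_neg fun h' ↦ hc ((hmem i j).2 h') }
    have hT : T 0 0 = 1 := rfl
    have hS : qySet μ 1 (fun _ ↦ True) = {T} := by
      refine Set.eq_singleton_iff_unique_mem.2 ⟨⟨fun i j hij ↦ ?_, ?_, 1, 0, by simp, trivial,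
        ⟨0, (hmem 0 0).2 ⟨rfl, rfl⟩, hT⟩, fun i j hij ↦ ?_⟩, fun T' hT' ↦ ?_⟩
      · obtain ⟨rfl, rfl⟩ := (hmem _ _).1 hij
        omega
      · rintro i r c hi ⟨h1, h2, -⟩
        obtain ⟨rfl, rfl⟩ := (hmem _ _).1 h1
        omega
      · obtain ⟨rfl, rfl⟩ := (hmem _ _).1 hij
        omega
      · ext i j
        by_cases hc : (i, j) ∈ μ
        · obtain ⟨rfl, rfl⟩ := (hmem _ _).1 hc
          rw [hT, (hval T' hT').2]
        · rw [T.zeros hc, T'.zeros hc]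
    simp [qyCount, hS]
  · have hS : qySet μ m (fun _ ↦ True) = ∅ :=
      Set.eq_empty_iff_forall_notMem.2 fun T hT ↦ hm (hval T hT).1
    simp [qyCount, hS]

/-- Arm cells leave the maximum unchanged and leg cells raise it by one, which forces `m = b + 1`;
the count then obeys Pascal's rule. -/
theorem IsDoubleHook.qyCount_hook : ∀ {a b : ℕ} {μ : YoungDiagram}, IsDoubleHook μ a b 0 0 →
    ∀ m : ℤ, qyCount μ m (fun _ ↦ True) =
      if m = b + 1 then ((a + 1).multichoose b : ℤ) else 0
  | 0, 0, μ, h, m => by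
    rw [qyCount_singleton h]
    simp
  | a + 1, 0, μ, h, m => by
    obtain ⟨ν, hν, hc⟩ := h.qyCount_arm (Nat.zero_le _)
    rw [qyCount_congr m (Q := (· = a + 1)), hc, qyCount_hook hν]
    · simp
    · intro r k h1 h2 h3
      rw [h] at h1 h2 h3
      simp only [true_iff]
      omega
  | 0, b + 1, μ, h, m => by
    obtain ⟨ν, hν, hc⟩ := h.qyCount_leg (by omega)
    rw [qyCount_congr m (Q := (· = 0)), hc, qyCount_hook hν]
    · push_cast
      simp only [sub_eq_iff_eq_add, Nat.multichoose_one]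
    · intro r k h1 h2 h3
      rw [h] at h1 h2 h3
      simp only [true_iff]
      omega
  | a + 1, b + 1, μ, h, m => by
    obtain ⟨ν, hν, hc⟩ := h.qyCount_arm (Nat.zero_le _)
    obtain ⟨ν', hν', hc'⟩ := h.qyCount_leg (by omega)
    rw [qyCount_add m (P := (· = a + 1)) (Q := (· = 0)), hc, hc', qyCount_hook hν,
      qyCount_hook hν', Nat.multichoose_succ_succ (a + 1) b]
    · push_cast
      simp only [sub_eq_iff_eq_add]
      split_ifs <;> simp
    · omega
    · intro r k h1 h2 h3
      rw [h] at h1 h2 h3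
      simp only [true_iff]
      omega
termination_by a b => a + b

theorem IsDoubleHook.qyCount_eq_hookDet (h : IsDoubleHook μ a b e d) (hea : e ≤ a)
    (hdb : d + 1 ≤ b) (hed : e = 0 → d = 0) (m : ℤ) :
    qyCount μ m (fun _ ↦ True) = hookDet (a + 1) b e d m := by
  induction hN : a + b + e + d using Nat.strong_induction_on generalizing μ a b e d m with
  | _ N ih =>
  obtain ⟨b, rfl⟩ : ∃ b', b = b' + 1 := ⟨b - 1, by omega⟩
  rcases e with _ | e
  · obtain rfl := hed rfl
    rw [h.qyCount_hook, hookDet_zero_zero]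
    push_cast
    simp only [add_assoc, one_add_one_eq_two]
  obtain ⟨a, rfl⟩ : ∃ a', a = a' + 1 := ⟨a - 1, by omega⟩
  have h_leg : ∀ m, qyCount μ m (· = 0) = hookDet (a + 1 + 1) b (e + 1) d (m - 1) := by
    intro m
    rcases Nat.lt_or_ge d b with hlt | hge
    · obtain ⟨ν, hν, hc⟩ := h.qyCount_leg (by omega)
      rw [hc, ih _ (by omega) hν hea (by omega) (by omega) _ rfl]
    -- Both legs end in the same row, so column 0 contains no corner.
    · obtain rfl : b = d := by omega
      rw [hookDet_self_leg]
      refine qyCount_eq_zero m fun r k h1 h2 h3 ↦ ?_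
      rw [h] at h1 h2 h3
      omega
  have h_arm : qyCount μ m (fun k ↦ k = a + 1 ∧ e < a) =
      hookDet (a + 1) (b + 1) (e + 1) d m := by
    rcases Nat.lt_or_ge e a with hlt | hge
    · obtain ⟨ν, hν, hc⟩ := h.qyCount_arm (by omega)
      rw [qyCount_congr m (Q := (· = a + 1)) (by simp [hlt]), hc,
        ih _ (by omega) hν (by omega) (by omega) (by omega) _ rfl]
    · obtain rfl : a = e := by omega
      rw [hookDet_self_arm]
      exact qyCount_eq_zero m (by simp)
  have h_inner_arm : qyCount μ m (fun k ↦ k = e + 1 ∧ (1 ≤ e ∨ d = 0)) =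
      hookDet (a + 1 + 1) (b + 1) e d m - hookDet (a + 1) (b + 1) e d m
        + hookDet (a + 1) (b + 1) e d (m - 1) := by
    by_cases hcond : 1 ≤ e ∨ d = 0
    · obtain ⟨ν, hν, hc⟩ := h.qyCount_inner_arm hea hdb hcond
      obtain ⟨ν', hν', hc'⟩ := hν.qyCount_arm (by omega)
      rw [qyCount_congr m (Q := (· = e + 1)) (by simp [hcond]), hc, hc', hc',
        ih _ (by omega) hν (by omega) (by omega) (by omega) _ rfl,
        ih _ (by omega) hν' (by omega) (by omega) (by omega) _ rfl,
        ih _ (by omega) hν' (by omega) (by omega) (by omega) _ rfl]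
    · obtain rfl : e = 0 := by omega
      obtain ⟨d, rfl⟩ : ∃ d', d = d' + 1 := ⟨d - 1, by omega⟩
      simp only [hookDet_zero_succ]
      exact qyCount_eq_zero m (by simp)
  -- Two ends may share a column: both inner ends if `e = 0`, both arms if `e = a`. The attached
  -- conditions keep only the end that is a corner, which makes the four classes disjoint.
  have h_split : qyCount μ m (fun _ ↦ True) =
      qyCount μ m (· = 0) + (qyCount μ m (fun k ↦ k = 1 ∧ 1 ≤ d) +
        (qyCount μ m (fun k ↦ k = e + 1 ∧ (1 ≤ e ∨ d = 0)) +
          qyCount μ m (fun k ↦ k = a + 1 ∧ e < a))) := by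
    rw [← qyCount_add m (P := fun k ↦ k = e + 1 ∧ (1 ≤ e ∨ d = 0)) (Q := fun k ↦ k = a + 1 ∧ e < a)
        (R := fun k ↦ (k = e + 1 ∧ (1 ≤ e ∨ d = 0)) ∨ (k = a + 1 ∧ e < a))
        (by omega) (fun _ _ _ _ _ ↦ Iff.rfl),
      ← qyCount_add m (P := fun k ↦ k = 1 ∧ 1 ≤ d)
        (R := fun k ↦ (k = 1 ∧ 1 ≤ d) ∨ (k = e + 1 ∧ (1 ≤ e ∨ d = 0)) ∨ (k = a + 1 ∧ e < a))
        (by omega) (fun _ _ _ _ _ ↦ Iff.rfl)]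
    refine qyCount_add m (by omega) fun r k h1 h2 h3 ↦ ?_
    rw [h] at h1 h2 h3
    simp only [true_iff]
    omega
  rw [h_split, h_leg, h_inner_arm, h_arm]
  rcases d with _ | d
  · rw [qyCount_eq_zero m (P := fun k ↦ k = 1 ∧ 1 ≤ 0) (by simp),
      hookDet_succ_zero (a + 1) b e m]
    ring
  · obtain ⟨ν, hν, hc⟩ := h.qyCount_inner_leg (by omega) hea (by omega)
    obtain ⟨ν', hν', hc'⟩ := hν.qyCount_leg (by omega)
    rw [qyCount_congr m (P := fun k ↦ k = 1 ∧ 1 ≤ d + 1) (Q := (· = 1)) (by simp), hc, hc', hc',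
      ih _ (by omega) hν (by omega) (by omega) (by omega) _ rfl,
      ih _ (by omega) hν' (by omega) (by omega) (by omega) _ rfl,
      ih _ (by omega) hν' (by omega) (by omega) (by omega) _ rfl, hookDet_succ (a + 1) b e d m,
      show m - 1 - 1 = m - 2 by ring]
    ring

end SemistandardYoungTableau

/-! ### From row lengths to the product formula -/

namespace YoungDiagram

theorem rowLen_eq_getD_rowLens (μ : YoungDiagram) (i : ℕ) : μ.rowLen i = μ.rowLens.getD i 0 := by
  rcases Nat.lt_or_ge i μ.rowLens.length with h | h
  · rw [List.getD_eq_getElem _ _ h]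
    exact get_rowLens.symm
  · rw [List.getD_eq_default _ _ h]
    rw [length_rowLens] at h
    have h0 : (i, 0) ∉ μ := by
      rw [mem_iff_lt_colLen]
      omega
    rw [mem_iff_lt_rowLen] at h0
    omega

theorem card_eq_sum_rowLens (μ : YoungDiagram) : μ.card = μ.rowLens.sum := by
  have hmaps : ∀ c ∈ μ.cells, c.1 ∈ Finset.range (μ.colLen 0) := by
    rintro ⟨i, j⟩ hc
    rw [mem_cells] at hc
    rw [Finset.mem_range, ← mem_iff_lt_colLen]
    exact μ.up_left_mem le_rfl (Nat.zero_le j) hc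
  calc μ.card = ∑ i ∈ Finset.range (μ.colLen 0), (μ.row i).card :=
        Finset.card_eq_sum_card_fiberwise hmaps
    _ = ∑ i ∈ Finset.range (μ.colLen 0), μ.rowLen i := by simp only [rowLen_eq_card]
    _ = μ.rowLens.sum := rfl

end YoungDiagram

theorem isDoubleHook_of_rowLens {l₁ l₂ d g : ℕ} {μ : YoungDiagram}
    (hμ : μ.rowLens = [l₁ + 1, l₂ + 2] ++ List.replicate d 2 ++ List.replicate g 1) :
    SemistandardYoungTableau.IsDoubleHook μ l₁ (d + g + 1) (l₂ + 1) d := by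
  intro i j
  rw [YoungDiagram.mem_iff_lt_rowLen, YoungDiagram.rowLen_eq_getD_rowLens, hμ]
  rcases i with _ | _ | i
  · simp
    omega
  · simp
    omega
  · have : ([l₁ + 1, l₂ + 2] ++ List.replicate d 2 ++ List.replicate g 1).getD (i + 1 + 1) 0 =
        if i < d then 2 else if i < d + g then 1 else 0 := by
      simp only [List.cons_append, List.nil_append, List.getD_cons_succ]
      rw [List.getD_eq_getElem?_getD, List.getElem?_append]
      simp only [List.length_replicate, List.getElem?_replicate]
      split_ifs <;> first | rfl | omega
    rw [this, or_iff_right (by omega)]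
    clear this hμ
    split_ifs <;> omega

theorem cast_choose_eq_div_factorial {n k r : ℕ} (h : n = k + r) :
    (n.choose k : ℚ) = n.factorial / (k.factorial * r.factorial) := by
  subst h
  exact Nat.cast_add_choose ℚ

/-- For a double hook, the determinantal expression factors. -/
theorem hookDet_eq_prod (E w d g j s : ℕ) (hs : E + d + 1 = j + s) :
    (hookDet (E + w + 2) (d + g + 1) (E + 1) d ((j + d + g + 2 : ℕ) : ℤ) : ℚ) =
      ((w : ℚ) + 1) / ((j : ℚ) + g + 1)
        * ((E + w + d + g + 2).choose (j + g) : ℚ)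
        * ((E + d + g + 1).choose (j + g) : ℚ)
        * ((j + g).choose j : ℚ)
        * ((E + d).choose d : ℚ)
        * ((E + w + d + 1).choose d : ℚ)
        * (1 / ((d + g + 1).choose d : ℚ)) := by
  have e1 : ((j + d + g + 2 : ℕ) : ℤ) - (d : ℕ) - 1 = ((j + g + 1 : ℕ) : ℤ) := by push_cast; ring
  have e2 : ((j + d + g + 2 : ℕ) : ℤ) - (d + g + 1 : ℕ) - 1 = ((j : ℕ) : ℤ) := by push_cast; ring
  simp only [hookDet, hookPair, e1, e2, chooseInt_natCast, Nat.multichoose_eq]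
  push_cast
  rw [show E + w + 2 + (d + g + 1) - 1 = E + w + d + g + 2 by omega,
    show E + 1 + d - 1 = E + d by omega, show d + g + 1 + (E + 1) = E + d + g + 1 + 1 by ring,
    show E + w + 2 + d = E + w + d + 1 + 1 by ring,
    show E + w + d + 1 + 1 - 1 = E + w + d + 1 by omega,
    show E + 1 + (d + g + 1) - 1 = E + d + g + 1 by omega, show d + (E + 1) = E + d + 1 by ring,
    show E + w + 2 + (d + g + 1) = E + w + d + g + 2 + 1 by ring]
  rw [cast_choose_eq_div_factorial (n := E + w + d + g + 2) (k := d + g + 1) (r := E + w + 1)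
      (by ring),
    cast_choose_eq_div_factorial (n := E + d) (k := d) (r := E) (by ring),
    cast_choose_eq_div_factorial (n := E + d + g + 1 + 1) (k := j + g + 1) (r := s) (by omega),
    cast_choose_eq_div_factorial (n := E + w + d + 1 + 1) (k := j) (r := s + w + 1) (by omega),
    cast_choose_eq_div_factorial (n := E + w + d + 1) (k := d) (r := E + w + 1) (by ring),
    cast_choose_eq_div_factorial (n := E + d + g + 1) (k := d + g + 1) (r := E) (by ring),
    cast_choose_eq_div_factorial (n := E + d + 1) (k := j) (r := s) (by omega),
    cast_choose_eq_div_factorial (n := E + w + d + g + 2 + 1) (k := j + g + 1) (r := s + w + 1)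
      (by omega),
    cast_choose_eq_div_factorial (n := E + w + d + g + 2) (k := j + g) (r := s + w + 1) (by omega),
    cast_choose_eq_div_factorial (n := E + d + g + 1) (k := j + g) (r := s) (by omega),
    cast_choose_eq_div_factorial (n := j + g) (k := j) (r := g) rfl,
    cast_choose_eq_div_factorial (n := d + g + 1) (k := d) (r := g + 1) (by ring),
    Nat.factorial_succ (E + d + g + 1), Nat.factorial_succ (E + w + d + 1),
    Nat.factorial_succ (E + d), Nat.factorial_succ (E + w + d + g + 2), Nat.factorial_succ (j + g),
    Nat.factorial_succ g]
  have hf : ∀ n : ℕ, (n.factorial : ℚ) ≠ 0 := fun n ↦ by exact_mod_cast n.factorial_ne_zero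
  have hjg : (j : ℚ) + g + 1 ≠ 0 := by positivity
  push_cast
  -- The factorials become opaque symbols, leaving a rational identity.
  generalize ((E + w + d + g + 2).factorial : ℚ) = X1
  generalize ((E + d + g + 1).factorial : ℚ) = X2
  generalize ((E + w + d + 1).factorial : ℚ) = X3
  generalize ((E + d).factorial : ℚ) = X4
  generalize hy1 : ((d + g + 1).factorial : ℚ) = Y1
  generalize hy2 : ((E + w + 1).factorial : ℚ) = Y2
  generalize hy3 : ((s + w + 1).factorial : ℚ) = Y3
  generalize hy4 : ((j + g).factorial : ℚ) = Y4
  have := hy1 ▸ hf (d + g + 1)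
  have := hy2 ▸ hf (E + w + 1)
  have := hy3 ▸ hf (s + w + 1)
  have := hy4 ▸ hf (j + g)
  have := hf d
  have := hf g
  have := hf j
  have := hf s
  have := hf E
  -- After common factors cancel, the core is `(u + g + 1) * (u + w + 1) - u * (u + w + g + 2) = (g
  -- + 1) * (w + 1)` with `u = E + d + 1`.
  field_simp
  ring

theorem theorem4p1 (l₁ l₂ h₁ h₂ n m : ℕ)
    (hl₁ : 2 ≤ l₁) (hl₂ : 2 ≤ l₂) (hh₁ : 2 ≤ h₁) (hh₂ : 2 ≤ h₂) (hh : h₂ ≤ h₁)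
    (μ : YoungDiagram)
    (hμ : μ.rowLens =
      [l₁, l₂] ++ List.replicate (h₂ - 2) 2 ++ List.replicate (h₁ - h₂) 1)
    (hn : μ.card = n) (hm₁ : h₁ ≤ m) (hm₂ : m ≤ n - (l₁ - 1)) :
    ((quasiYamanouchiEq μ m).ncard : ℚ) =
      ((l₁ : ℚ) - l₂ + 1) / ((m : ℚ) - h₂ + 1)
        * (Nat.choose (l₁ + h₁ - 2) (m - h₂) : ℚ)
        * (Nat.choose (l₂ + h₁ - 3) (m - h₂) : ℚ)
        * (Nat.choose (m - h₂) (m - h₁) : ℚ)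
        * (Nat.choose (l₂ + h₂ - 4) (h₂ - 2) : ℚ)
        * (Nat.choose (l₁ + h₂ - 3) (h₂ - 2) : ℚ)
        * (1 / (Nat.choose (h₁ - 1) (h₂ - 2) : ℚ)) := by
  have hle : l₂ ≤ l₁ := by
    have h := μ.rowLen_anti 0 1 zero_le_one
    simpa [YoungDiagram.rowLen_eq_getD_rowLens, hμ] using h
  obtain ⟨d, rfl⟩ := Nat.exists_eq_add_of_le' hh₂
  obtain ⟨g, rfl⟩ := Nat.exists_eq_add_of_le hh
  obtain ⟨E, rfl⟩ := Nat.exists_eq_add_of_le' hl₂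
  obtain ⟨w, rfl⟩ := Nat.exists_eq_add_of_le hle
  obtain ⟨j, rfl⟩ := Nat.exists_eq_add_of_le' hm₁
  have hμ' : μ.rowLens =
      [E + w + 1 + 1, E + 2] ++ List.replicate d 2 ++ List.replicate g 1 := by
    rw [hμ, show E + 2 + w = E + w + 1 + 1 by ring, show d + 2 - 2 = d by omega,
      show d + 2 + g - (d + 2) = g by omega]
  have hcard : n = E + w + 2 + (E + 2) + d * 2 + g := by
    rw [← hn, μ.card_eq_sum_rowLens, hμ']
    simp
    ring
  -- The upper bound on `m` amounts to `j ≤ E + d + 1`; the slack `s` provides the complementary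
  -- factorials.
  obtain ⟨s, hs⟩ : ∃ s, E + d + 1 = j + s := Nat.exists_eq_add_of_le (by omega)
  have hcount := (isDoubleHook_of_rowLens hμ').qyCount_eq_hookDet (by omega) (by omega)
    (by omega) ((j + d + g + 2 : ℕ) : ℤ)
  rw [SemistandardYoungTableau.qyCount, SemistandardYoungTableau.qySet_true] at hcount
  have hprod := hookDet_eq_prod E w d g j s hs
  rw [show E + w + 2 = E + w + 1 + 1 by ring, ← hcount, Int.cast_natCast] at hprod
  rw [show j + (d + 2 + g) = j + d + g + 2 by ring, hprod,
    show E + 2 + w + (d + 2 + g) - 2 = E + w + d + g + 2 by omega,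
    show j + d + g + 2 - (d + 2) = j + g by omega,
    show E + 2 + (d + 2 + g) - 3 = E + d + g + 1 by omega,
    show j + d + g + 2 - (d + 2 + g) = j by omega,
    show E + 2 + (d + 2) - 4 = E + d by omega, show d + 2 - 2 = d by omega,
    show E + 2 + w + (d + 2) - 3 = E + w + d + 1 by omega,
    show d + 2 + g - 1 = d + g + 1 by omega]
  push_cast
  congr 7 <;> ring
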